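/- Let $\sigma_h,\sigma_v\in\mathbb{Z}$ with $\gcd(\sigma_h,\sigma_v)=1$, and let $$\mathbb{Z}^2_\times=\{(i\sigma_h+j\sigma_v,\; i\sigma_v-j\sigma_h) : (i,j)\in\mathbb{Z}^2\}\subset\mathbb{Z}^2 .$$ For $u:\mathbb{Z}^2_\times\to\mathbb{R}$ put $$[\Delta^\times u]_{n,l}=u_{n+\sigma_h,l+\sigma_v}+u_{n+\sigma_v,l-\sigma_h}+u_{n-\sigma_h,l-\sigma_v}+u_{n-\sigma_v,l+\sigma_h}-4u_{n,l}.$$ Let $g:\mathbb{R}\to\mathbb{R}$ be $C^3$-smooth, with $g'(0)=g'(1)<0$, and suppose that there is $a\in(0,1)$ such that $g(0)=g(a)=g(1)=0$, $g>0$ on $(-\infty,0)\cup(a,1)$ and $g<0$ on $(0,a)\cup(1,\infty)$. Let $c_*\neq 0$ and let $\Phi_*:\mathbb{R}\to\mathbb{R}$ be a non-decreasing differentiable function such that, for all $\xi\in\mathbb{R}$, $$-c_*\Phi_*'(\xi)=\Phi_*(\xi+\sigma_h)+\Phi_*(\xi+\sigma_v)+\Phi_*(\xi-\sigma_h)+\Phi_*(\xi-\sigma_v)-4\Phi_*(\xi)+g(\Phi_*(\xi)),$$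 with $\lim_{\xi\to-\infty}\Phi_*(\xi)=0$, $\lim_{\xi\to\infty}\Phi_*(\xi)=1$ and $\Phi_*(0)=\tfrac12$. Let $\omega\in C^1(\mathbb{R};\ell^\infty(\mathbb{Z}^2_\times))$ satisfy the discrete Allen--Cahn equation $$\dot\omega_{n,l}(t)=[\Delta^\times\omega(t)]_{n,l}+g(\omega_{n,l}(t))\qquad\text{for all }(n,l)\in\mathbb{Z}^2_\times,\ t\in\mathbb{R},$$ and suppose that there is a constant $\theta\in\mathbb{R}$ such that $$\Phi_*(n-c_*t-\theta)\le\omega_{n,l}(t)\le\Phi_*(n-c_*t+\theta)\qquad\text{for all }(n,l)\in\mathbb{Z}^2_\times,\ t\in\mathbb{R}.$$ Then there is a constant $\theta_0\in[-\theta,\theta]$ such that $$\omega_{n,l}(t)=\Phi_*(n-c_*t+\theta_0)\qquad\text{for all }(n,l)\in\mathbb{Z}^2_\times,\ t\in\mathbb{R}.$$ -/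

import Mathlib

open scoped ENNReal

namespace AllenCahnLattice

/-- The lattice `ℤ²_×`, that is the set of all `(n, l) = (i σₕ + j σᵥ, i σᵥ - j σₕ)`
with `(i, j) ∈ ℤ²`. -/
def latticeX (σh σv : ℤ) : AddSubgroup (ℤ × ℤ) where
  carrier := {q | ∃ i j : ℤ, q.1 = i * σh + j * σv ∧ q.2 = i * σv - j * σh}
  zero_mem' := ⟨0, 0, by simp, by simp⟩
  add_mem' := by
    rintro p q ⟨i, j, h1, h2⟩ ⟨i', j', h1', h2'⟩
    refine ⟨i + i', j + j', ?_, ?_⟩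
    · rw [Prod.fst_add, h1, h1']; ring
    · rw [Prod.snd_add, h2, h2']; ring
  neg_mem' := by
    rintro p ⟨i, j, h1, h2⟩
    refine ⟨-i, -j, ?_, ?_⟩
    · rw [Prod.fst_neg, h1]; ring
    · rw [Prod.snd_neg, h2]; ring

/-- The displacement `(σₕ, σᵥ)`, the image of `(i, j) = (1, 0)`. -/
def stepH (σh σv : ℤ) : latticeX σh σv :=
  ⟨(σh, σv), 1, 0, by simp, by simp⟩

/-- The displacement `(σᵥ, -σₕ)`, the image of `(i, j) = (0, 1)`. -/
def stepV (σh σv : ℤ) : latticeX σh σv :=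
  ⟨(σv, -σh), 0, 1, by simp, by simp⟩

/-- The discrete Laplacian `Δ^×` in the `(n, l)` coordinates. -/
def laplacianX (σh σv : ℤ) (u : latticeX σh σv → ℝ) (p : latticeX σh σv) : ℝ :=
  u (p + stepH σh σv) + u (p + stepV σh σv) + u (p - stepH σh σv) + u (p - stepV σh σv) - 4 * u p

/-- The bistability condition on the nonlinearity `g`. -/
structure Bistable (g : ℝ → ℝ) : Prop where
  smooth : ContDiff ℝ 3 g
  deriv_eq : deriv g 0 = deriv g 1
  deriv_neg : deriv g 1 < 0
  zeros_and_signs : ∃ a ∈ Set.Ioo (0 : ℝ) 1,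
    g 0 = 0 ∧ g a = 0 ∧ g 1 = 0 ∧
    (∀ x ∈ Set.Iio (0 : ℝ) ∪ Set.Ioo a 1, 0 < g x) ∧
    (∀ x ∈ Set.Ioo 0 a ∪ Set.Ioi (1 : ℝ), g x < 0)

/-- `(c, Φ)` is a monotone wave pair with nonzero speed in the direction `(σₕ, σᵥ)`, connecting
`0` to `1`, with the phase normalization `Φ 0 = 1 / 2`. -/
structure IsWavePair (σh σv : ℤ) (g : ℝ → ℝ) (c : ℝ) (Φ : ℝ → ℝ) : Prop where
  speed_ne_zero : c ≠ 0
  monotone : Monotone Φ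
  differentiable : Differentiable ℝ Φ
  mfde : ∀ ξ : ℝ, -c * deriv Φ ξ =
    Φ (ξ + σh) + Φ (ξ + σv) + Φ (ξ - σh) + Φ (ξ - σv) - 4 * Φ ξ + g (Φ ξ)
  tendsto_atBot : Filter.Tendsto Φ Filter.atBot (nhds 0)
  tendsto_atTop : Filter.Tendsto Φ Filter.atTop (nhds 1)
  phase : Φ 0 = 1 / 2

/-- `u ∈ C¹(ℝ; ℓ^∞(ℤ²_×))` satisfies the discrete Allen–Cahn equation
`u̇ = Δ^× u + g(u)` on `ℤ²_×` for all `t ∈ ℝ`. -/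
structure IsEntireSolution (σh σv : ℤ) (g : ℝ → ℝ)
    (u : ℝ → lp (fun _ : latticeX σh σv => ℝ) ∞) : Prop where
  contDiff : ContDiff ℝ 1 u
  lde : ∀ (t : ℝ) (p : latticeX σh σv),
    (deriv u t) p = laplacianX σh σv (fun q => u t q) p + g (u t p)

end AllenCahnLattice

/-! This is a sliding argument in which a Harnack inequality replaces compactness. Call `x = n - c
t` the phase. Far from the interface both ordered objects are near the same stable state, where `g`
is decreasing, so order there follows from a minimum principle (`nonneg_of_damped_below`). Hence a
sliding family can only be stopped by loss of a uniform gap on a strip `|x| ≤ L` (`le_of_sliding`).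

Sliding space-time translates of `u` first: a translate that advances the phase always keeps such a
gap, since otherwise Harnack would make `u` nearly constant along a chain of translates crossing the
whole interface. So sliding reaches phase shift zero, and `u` depends on `x` alone
(`eq_of_phase_eq`).

Next the wave is slid down onto `u`. It must stop, and on a compact phase interval the lost gap
becomes genuine contact. The contact phase recurs at arbitrarily late times, and Harnack carries
equality back to every earlier point. -/

namespace AllenCahnLattice

/-! ### Comparison principles for the lattice heat operator -/

/-- A function is non-increasing to first order at a point where it is minimal from the left. -/
lemma deriv_nonpos_of_forall_left_ge {y : ℝ → ℝ} {y' s a : ℝ} (has : a < s)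
    (hy : HasDerivAt y y' s) (hmin : ∀ r ∈ Set.Icc a s, y s ≤ y r) : y' ≤ 0 := by
  have h := (hasDerivAt_iff_tendsto_slope_left_right.1 hy).1
  refine le_of_tendsto h ?_
  filter_upwards [Ioo_mem_nhdsLT has] with r hr
  rw [slope_def_field]
  exact div_nonpos_of_nonneg_of_nonpos (sub_nonneg.2 (hmin r ⟨hr.1.le, hr.2.le⟩))
    (sub_nonpos.2 hr.2.le)

/-- A function on the line that is bounded below and increases at a rate at least
`m (κ - z)` wherever it is below the level `κ` stays above `κ`. -/
lemma le_of_deriv_ge_below {z z' : ℝ → ℝ} {B κ m : ℝ} (hm : 0 < m)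
    (hz : ∀ t, HasDerivAt z (z' t) t) (hB : ∀ t, -B ≤ z t)
    (hrate : ∀ t, z t < κ → m * (κ - z t) ≤ z' t) (t : ℝ) : κ ≤ z t := by
  by_contra! hlt
  -- The tilt `η` is half the growth rate forced at `t`, so a minimum of the tilted function
  -- contradicts `hrate`. The window length `R` makes the tilt exceed any drop allowed by the lower
  -- bound, which excludes the left endpoint.
  set η := m * (κ - z t) / 2 with hη
  have hη0 : 0 < η := by have : 0 < κ - z t := by linarith
                         positivity
  set R := (z t + B) / η + 1 with hR
  have hR0 : 0 < R := by
    have := hB t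
    have : 0 ≤ (z t + B) / η := div_nonneg (by linarith) hη0.le
    linarith
  have hηR : η * R = z t + B + η := by rw [hR]; field_simp
  have hder : ∀ s, HasDerivAt (fun s => z s + η * (t - s)) (z' s - η) s := fun s => by
    exact ((hz s).add (((hasDerivAt_id s).const_sub t).const_mul η)).congr_deriv (by ring)
  obtain ⟨s, hs, hmin⟩ := (isCompact_Icc (a := t - R) (b := t)).exists_isMinOn
    ⟨t, by constructor <;> linarith⟩
    (f := fun s => z s + η * (t - s)) (fun s _ => (hder s).continuousAt.continuousWithinAt)
  have hst : z s + η * (t - s) ≤ z t + η * (t - t) := hmin (by constructor <;> linarith)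
  have hts : 0 ≤ η * (t - s) := mul_nonneg hη0.le (by linarith [hs.2])
  have hzs : z s ≤ z t := by linarith
  have hleft : t - R < s := by
    rcases hs.1.lt_or_eq with h | h
    · exact h
    · have : t - s = R := by linarith
      rw [this, hηR] at hst
      linarith [hB s]
  have h0 := deriv_nonpos_of_forall_left_ge hleft (hder s)
    (fun r hr => hmin ⟨hr.1, hr.2.trans hs.2⟩)
  have h1 := hrate s (by linarith)
  have h2 : m * (κ - z t) ≤ m * (κ - z s) := by gcongr
  linarith

variable {σh σv : ℤ}

/-- Minimum principle: a bounded entire supersolution of a lattice heat equation that is damped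
wherever the supersolution is negative is nonnegative. -/
lemma nonneg_of_damped_below {w d : latticeX σh σv → ℝ → ℝ} {B β : ℝ} (hβ : 0 < β)
    (hw : ∀ p t, HasDerivAt (w p) (d p t) t) (hB : ∀ p t, -B ≤ w p t)
    (hd : ∀ p t, w p t < 0 → laplacianX σh σv (fun q => w q t) p - β * w p t ≤ d p t)
    (p : latticeX σh σv) (t : ℝ) : 0 ≤ w p t := by
  -- A lower bound `-C` on the four neighbours improves the bound at each site by the factor `4 / (4
  -- + β) < 1`. Iterating avoids any need for the infimum over the lattice to be attained.
  have key : ∀ C, 0 ≤ C → (∀ p t, -C ≤ w p t) → ∀ p t, -(4 / (4 + β) * C) ≤ w p t := by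
    intro C hC0 hC p
    refine le_of_deriv_ge_below (m := 4 + β) (by linarith) (hw p) (hC p) fun t ht => ?_
    have hneg : w p t < 0 := ht.trans_le (by rw [neg_nonpos]; positivity)
    have heq : (4 + β) * (-(4 / (4 + β) * C) - w p t) = -4 * C - (4 + β) * w p t := by
      field_simp
    refine le_trans (heq.le.trans ?_) (hd p t hneg)
    · have h1 := hC (p + stepH σh σv) t
      have h2 := hC (p + stepV σh σv) t
      have h3 := hC (p - stepH σh σv) t
      have h4 := hC (p - stepV σh σv) t
      unfold laplacianX
      linarith
  have hB' : ∀ k : ℕ, ∀ p t, -((4 / (4 + β)) ^ k * max B 0) ≤ w p t := by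
    intro k
    induction k with
    | zero =>
      intro p t
      have := hB p t
      have := le_max_left B 0
      simp only [pow_zero, one_mul]
      linarith
    | succ k ih =>
      rw [pow_succ', mul_assoc]
      exact key _ (by positivity) ih
  have hlim : Filter.Tendsto (fun k : ℕ => -((4 / (4 + β)) ^ k * max B 0)) Filter.atTop
      (nhds (-(0 * max B 0))) :=
    ((tendsto_pow_atTop_nhds_zero_of_lt_one (by positivity)
      (by rw [div_lt_one (by linarith)]; linarith)).mul_const _).neg
  simpa using le_of_tendsto hlim (Filter.Eventually.of_forall fun k => hB' k p t)

/-- The lattice is generated by its two basic displacements. -/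
lemma latticeX_induction {P : latticeX σh σv → Prop} (h0 : P 0)
    (hH : P (stepH σh σv)) (hH' : P (-stepH σh σv)) (hV : P (stepV σh σv))
    (hV' : P (-stepV σh σv)) (hadd : ∀ p q, P p → P q → P (p + q)) (r : latticeX σh σv) : P r := by
  have hmul : ∀ e : latticeX σh σv, P e → P (-e) → ∀ i : ℤ, P (i • e) := by
    intro e he he' i
    induction i with
    | zero => simpa using h0
    | succ k ih => rw [add_smul, one_smul]; exact hadd _ _ ih he
    | pred k ih => rw [sub_smul, one_smul, sub_eq_add_neg]; exact hadd _ _ ih he'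
  obtain ⟨⟨n, l⟩, i, j, hn, hl⟩ := r
  have : (⟨(n, l), i, j, hn, hl⟩ : latticeX σh σv) = i • stepH σh σv + j • stepV σh σv := by
    apply Subtype.ext
    ext
    · simpa [stepH, stepV] using hn
    · simp [stepH, stepV] at hl ⊢; linarith
  rw [this]
  exact hadd _ _ (hmul _ hH hH' i) (hmul _ hV hV' j)

/-- Harnack inequality: the past values of a nonnegative supersolution are controlled by its
present values, uniformly with respect to translations. -/
lemma exists_harnack {w d : latticeX σh σv → ℝ → ℝ} {K : ℝ}
    (hw : ∀ p t, HasDerivAt (w p) (d p t) t) (hpos : ∀ p t, 0 ≤ w p t)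
    (hd : ∀ p t, laplacianX σh σv (fun q => w q t) p - K * w p t ≤ d p t)
    (r : latticeX σh σv) (T : ℝ) (hT : 0 < T) :
    ∃ C : ℝ, 0 ≤ C ∧ ∀ p t, w (p + r) (t - T) ≤ C * w p t := by
  -- This weight absorbs all diagonal terms: the derivative of `exp (M t) * w p` dominates the
  -- weighted sum of the neighbours, hence each of them.
  set M := 4 + K with hM
  have hder : ∀ p t, HasDerivAt (fun s => Real.exp (M * s) * w p s)
      (Real.exp (M * t) * (d p t + M * w p t)) t := fun p t => by
    exact ((((hasDerivAt_id t).const_mul M).exp).mul (hw p t)).congr_deriv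
      (by simp only [id]; ring)
  have hnbr : ∀ p t, w (p + stepH σh σv) t + w (p + stepV σh σv) t + w (p - stepH σh σv) t
      + w (p - stepV σh σv) t ≤ d p t + M * w p t := fun p t => by
    have := hd p t
    simp only [laplacianX] at this
    linarith
  have hmono : ∀ p, Monotone fun s => Real.exp (M * s) * w p s := fun p =>
    monotone_of_hasDerivAt_nonneg (hder p) fun t => by
      have := hnbr p t
      have := hpos (p + stepH σh σv) t
      have := hpos (p + stepV σh σv) t
      have := hpos (p - stepH σh σv) t
      have := hpos (p - stepV σh σv) t
      exact mul_nonneg (Real.exp_pos _).le (by linarith)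
  have hstep : ∀ e : latticeX σh σv, (∀ p t, w (p + e) t ≤ d p t + M * w p t) → ∀ T : ℝ, 0 < T →
      ∃ C : ℝ, 0 ≤ C ∧ ∀ p t, w (p + e) (t - T) ≤ C * w p t := by
    intro e he T hT
    refine ⟨Real.exp (M * T) / T, by positivity, fun p t => ?_⟩
    have hmv := (convex_Icc (t - T) t).mul_sub_le_image_sub_of_le_deriv
      (f := fun s => Real.exp (M * s) * w p s)
      (fun s _ => (hder p s).continuousAt.continuousWithinAt)
      (fun s _ => (hder p s).differentiableAt.differentiableWithinAt)
      (C := Real.exp (M * (t - T)) * w (p + e) (t - T))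
      (fun s hs => by
        rw [(hder p s).deriv]
        rw [interior_Icc] at hs
        exact (hmono (p + e) hs.1.le).trans
          (mul_le_mul_of_nonneg_left (he p s) (Real.exp_pos _).le))
      (t - T) (by constructor <;> linarith) t (by constructor <;> linarith) (by linarith)
    have h0 : 0 ≤ Real.exp (M * (t - T)) * w p (t - T) := mul_nonneg (Real.exp_pos _).le (hpos _ _)
    have hE : Real.exp (M * t) = Real.exp (M * (t - T)) * Real.exp (M * T) := by
      rw [← Real.exp_add]; ring_nf
    rw [sub_sub_cancel, hE] at hmv
    rw [div_mul_eq_mul_div, le_div_iff₀ hT]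
    refine le_of_mul_le_mul_left ?_ (Real.exp_pos (M * (t - T)))
    nlinarith [hmv, h0]
  refine latticeX_induction (P := fun r => ∀ T : ℝ, 0 < T →
      ∃ C : ℝ, 0 ≤ C ∧ ∀ p t, w (p + r) (t - T) ≤ C * w p t) ?_ ?_ ?_ ?_ ?_ ?_ r T hT
  · refine fun T hT => ⟨Real.exp (M * T), (Real.exp_pos _).le, fun p t => ?_⟩
    have := hmono p (show t - T ≤ t by linarith)
    have hE : Real.exp (M * t) = Real.exp (M * (t - T)) * Real.exp (M * T) := by
      rw [← Real.exp_add]; ring_nf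
    simp only [hE, mul_assoc] at this
    simpa using le_of_mul_le_mul_left this (Real.exp_pos _)
  all_goals first
    | refine hstep _ fun p t => ?_
      have := hnbr p t
      have := hpos (p + stepH σh σv) t
      have := hpos (p + stepV σh σv) t
      have := hpos (p - stepH σh σv) t
      have := hpos (p - stepV σh σv) t
      try simp only [← sub_eq_add_neg]
      linarith
    | skip
  intro q r hq hr T hT
  -- Displacements compose by splitting the elapsed time in two.
  obtain ⟨C, hC0, hC⟩ := hq (T / 2) (by linarith)
  obtain ⟨C', hC0', hC'⟩ := hr (T / 2) (by linarith)
  refine ⟨C' * C, by positivity, fun p t => ?_⟩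
  have h1 := hC' (p + q) (t - T / 2)
  have h2 := mul_le_mul_of_nonneg_left (hC p t) hC0'
  rw [← add_assoc, show t - T = t - T / 2 - T / 2 by ring, mul_assoc]
  exact h1.trans h2

/-! ### The nonlinearity -/

lemma Bistable.exists_lipschitz {g : ℝ → ℝ} (hg : Bistable g) :
    ∃ K : ℝ, 0 ≤ K ∧ ∀ x ∈ Set.Icc (0 : ℝ) 1, ∀ y ∈ Set.Icc (0 : ℝ) 1,
      |g y - g x| ≤ K * |y - x| := by
  obtain ⟨K, hK⟩ := (isCompact_Icc (a := (0 : ℝ)) (b := 1)).exists_bound_of_continuousOn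
    (hg.smooth.continuous_deriv (by norm_num)).continuousOn
  refine ⟨K, (norm_nonneg _).trans (hK 0 (by simp)), fun x hx y hy => ?_⟩
  exact (convex_Icc (0 : ℝ) 1).norm_image_sub_le_of_norm_deriv_le
    (fun z _ => (hg.smooth.differentiable (by norm_num)).differentiableAt) hK hx hy

lemma Bistable.exists_decreasing_near {g : ℝ → ℝ} (hg : Bistable g) {z : ℝ} (hz : deriv g z < 0) :
    ∃ β > 0, ∃ δ > 0, ∀ x y, |x - z| < δ → |y - z| < δ → x ≤ y →
      g y - g x ≤ -β * (y - x) := by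
  have hc : ContinuousAt (deriv g) z :=
    (hg.smooth.continuous_deriv (by norm_num)).continuousAt
  obtain ⟨δ, hδ, h⟩ := Metric.eventually_nhds_iff_ball.1
    (hc.eventually_lt continuousAt_const (show deriv g z < deriv g z / 2 by linarith))
  have hd : Differentiable ℝ g := hg.smooth.differentiable (by norm_num)
  refine ⟨-(deriv g z / 2), by linarith, δ, hδ, fun x y hx hy hxy => ?_⟩
  rw [neg_neg]
  exact (convex_ball z δ).image_sub_le_mul_sub_of_deriv_le hd.continuous.continuousOn
    hd.differentiableOn (fun w hw => (h w (interior_subset hw)).le) x hx y hy hxy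

/-- The nonlinearity is strictly decreasing near both stable equilibria. -/
lemma Bistable.exists_damping {g : ℝ → ℝ} (hg : Bistable g) :
    ∃ β > 0, ∃ δ > 0, ∀ x ∈ Set.Icc (0 : ℝ) 1, ∀ y ∈ Set.Icc (0 : ℝ) 1, x ≤ y →
      (y < δ ∨ 1 - δ < x) → g y - g x ≤ -β * (y - x) := by
  obtain ⟨β₀, hβ₀, δ₀, hδ₀, h₀⟩ := hg.exists_decreasing_near (hg.deriv_eq ▸ hg.deriv_neg)
  obtain ⟨β₁, hβ₁, δ₁, hδ₁, h₁⟩ := hg.exists_decreasing_near hg.deriv_neg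
  refine ⟨min β₀ β₁, lt_min hβ₀ hβ₁, min δ₀ δ₁, lt_min hδ₀ hδ₁, fun x hx y hy hxy h => ?_⟩
  rcases h with h | h
  · have hlt := h.trans_le (min_le_left _ _)
    refine (h₀ x y ?_ ?_ hxy).trans ?_
    · rw [sub_zero, abs_of_nonneg hx.1]; linarith
    · rw [sub_zero, abs_of_nonneg hy.1]; linarith
    · nlinarith [min_le_left β₀ β₁]
  · have hlt := min_le_right δ₀ δ₁
    refine (h₁ x y ?_ ?_ hxy).trans ?_
    · rw [abs_of_nonpos (by linarith [hx.2])]; linarith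
    · rw [abs_of_nonpos (by linarith [hy.2])]; linarith
    · nlinarith [min_le_right β₀ β₁]

/-! ### Solutions with values in the unit interval -/

variable {g : ℝ → ℝ}

/-- Pointwise entire solutions of the lattice Allen–Cahn equation with values in `[0, 1]`. -/
structure IsUnitSolution (g : ℝ → ℝ) (u : latticeX σh σv → ℝ → ℝ) : Prop where
  hasDerivAt : ∀ p t, HasDerivAt (u p) (laplacianX σh σv (fun q => u q t) p + g (u p t)) t
  mem_Icc : ∀ p t, u p t ∈ Set.Icc (0 : ℝ) 1

namespace IsUnitSolution

variable {u v : latticeX σh σv → ℝ → ℝ}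

lemma translate (hu : IsUnitSolution g u) (q : latticeX σh σv) (τ : ℝ) :
    IsUnitSolution g (fun p t => u (p + q) (t + τ)) where
  hasDerivAt p t := by
    have := (hu.hasDerivAt (p + q) (t + τ)).comp_add_const t τ
    refine this.congr_deriv ?_
    simp only [laplacianX, add_right_comm p _ q, sub_add_eq_add_sub]
  mem_Icc p t := hu.mem_Icc _ _

lemma hasDerivAt_sub (hu : IsUnitSolution g u) (hv : IsUnitSolution g v) (p : latticeX σh σv)
    (t : ℝ) : HasDerivAt (fun t => v p t - u p t)
      (laplacianX σh σv (fun q => v q t - u q t) p + (g (v p t) - g (u p t))) t := by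
  refine ((hv.hasDerivAt p t).sub (hu.hasDerivAt p t)).congr_deriv ?_
  simp only [laplacianX]
  ring

/-- Two solutions are ordered as soon as `g` is damping wherever they are not. -/
lemma le_of_damping (hu : IsUnitSolution g u) (hv : IsUnitSolution g v) {β : ℝ} (hβ : 0 < β)
    (h : ∀ p t, v p t < u p t → g (u p t) - g (v p t) ≤ -β * (u p t - v p t))
    (p : latticeX σh σv) (t : ℝ) : u p t ≤ v p t := by
  refine sub_nonneg.1 (nonneg_of_damped_below (w := fun p t => v p t - u p t) (B := 1) hβ
    (hu.hasDerivAt_sub hv) (fun p t => ?_) (fun p t hlt => ?_) p t)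
  · linarith [(hu.mem_Icc p t).2, (hv.mem_Icc p t).1]
  · linarith [h p t (sub_neg.1 hlt)]

/-- Harnack inequality for the difference of two ordered solutions. -/
lemma exists_harnack (hg : Bistable g) (hu : IsUnitSolution g u) (hv : IsUnitSolution g v)
    (huv : ∀ p t, u p t ≤ v p t) (r : latticeX σh σv) {T : ℝ} (hT : 0 < T) :
    ∃ C : ℝ, 0 ≤ C ∧ ∀ p t,
      v (p + r) (t - T) - u (p + r) (t - T) ≤ C * (v p t - u p t) := by
  obtain ⟨K, -, hK⟩ := hg.exists_lipschitz
  refine AllenCahnLattice.exists_harnack (K := K) (w := fun p t => v p t - u p t)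
    (hu.hasDerivAt_sub hv) (fun p t => sub_nonneg.2 (huv p t)) (fun p t => ?_) r T hT
  have h := (abs_le.1 (hK _ (hu.mem_Icc p t) _ (hv.mem_Icc p t))).1
  rw [abs_of_nonneg (sub_nonneg.2 (huv p t))] at h
  linarith

lemma exists_lipschitz_time (hg : Bistable g) : ∃ D : ℝ, 0 ≤ D ∧
    ∀ u : latticeX σh σv → ℝ → ℝ, IsUnitSolution g u → ∀ p s t, |u p t - u p s| ≤ D * |t - s| := by
  obtain ⟨G, hG⟩ := (isCompact_Icc (a := (0 : ℝ)) (b := 1)).exists_bound_of_continuousOn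
    hg.smooth.continuous.continuousOn
  have hG0 : 0 ≤ G := (norm_nonneg _).trans (hG 0 (by simp))
  refine ⟨4 + G, by linarith, fun u hu p s t => ?_⟩
  refine convex_univ.norm_image_sub_le_of_norm_hasDerivWithin_le (f := u p)
    (fun r _ => (hu.hasDerivAt p r).hasDerivWithinAt) (fun r _ => ?_)
    (Set.mem_univ s) (Set.mem_univ t)
  refine (norm_add_le _ _).trans (add_le_add ?_ (hG _ (hu.mem_Icc p r)))
  have h0 := hu.mem_Icc p r
  have h1 := hu.mem_Icc (p + stepH σh σv) r
  have h2 := hu.mem_Icc (p + stepV σh σv) r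
  have h3 := hu.mem_Icc (p - stepH σh σv) r
  have h4 := hu.mem_Icc (p - stepV σh σv) r
  rw [Real.norm_eq_abs, abs_le, laplacianX]
  constructor <;> linarith [h0.1, h1.1, h2.1, h3.1, h4.1, h0.2, h1.2, h2.2, h3.2, h4.2]

end IsUnitSolution

/-! ### Waves -/

namespace IsWavePair

variable {c : ℝ} {Φ : ℝ → ℝ}

lemma mem_Icc (hΦ : IsWavePair σh σv g c Φ) (x : ℝ) : Φ x ∈ Set.Icc (0 : ℝ) 1 :=
  ⟨hΦ.monotone.le_of_tendsto hΦ.tendsto_atBot x, hΦ.monotone.ge_of_tendsto hΦ.tendsto_atTop x⟩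

lemma isUnitSolution (hΦ : IsWavePair σh σv g c Φ) (s : ℝ) :
    IsUnitSolution g (fun (p : latticeX σh σv) t => Φ ((p.1.1 : ℝ) - c * t + s)) where
  hasDerivAt p t := by
    have h1 : HasDerivAt (fun t : ℝ => (p.1.1 : ℝ) - c * t + s) (-c) t :=
      ((((hasDerivAt_id t).const_mul c).const_sub (p.1.1 : ℝ)).add_const s).congr_deriv (by simp)
    refine ((hΦ.differentiable _).hasDerivAt.comp t h1).congr_deriv ?_
    rw [mul_comm, hΦ.mfde]
    simp only [laplacianX, stepH, stepV, AddSubgroup.coe_add, AddSubgroup.coe_sub, Prod.fst_add,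
      Prod.fst_sub, Int.cast_add, Int.cast_sub]
    ring_nf
  mem_Icc p t := hΦ.mem_Icc _

lemma exists_tails (hΦ : IsWavePair σh σv g c Φ) {δ : ℝ} (hδ : 0 < δ) :
    ∃ A : ℝ, 0 ≤ A ∧ (∀ x ≤ -A, Φ x < δ) ∧ ∀ x ≥ A, 1 - δ < Φ x := by
  obtain ⟨A₀, h₀⟩ := Filter.eventually_atBot.1 (hΦ.tendsto_atBot.eventually (gt_mem_nhds hδ))
  obtain ⟨A₁, h₁⟩ := Filter.eventually_atTop.1
    (hΦ.tendsto_atTop.eventually (lt_mem_nhds (show 1 - δ < 1 by linarith)))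
  refine ⟨|A₀| + |A₁|, by positivity, fun x hx => h₀ x ?_, fun x hx => h₁ x ?_⟩
  · linarith [neg_abs_le A₀, abs_nonneg A₁]
  · linarith [le_abs_self A₁, abs_nonneg A₀]

/-- Translates of the wave are ordered only if their phases are. -/
lemma le_of_translate_le (hΦ : IsWavePair σh σv g c Φ) {a b : ℝ}
    (h : ∀ x, Φ (x + a) ≤ Φ (x + b)) : a ≤ b := by
  by_contra! hlt
  -- If `b < a`, letting `k → ∞` gives `1 ≤ Φ x` everywhere, against the limit at `-∞`.
  have hstep : ∀ k : ℕ, ∀ x, Φ (x + k * (a - b)) ≤ Φ x := by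
    intro k
    induction k with
    | zero => simp
    | succ k ih =>
      intro x
      have := h (x + k * (a - b) - b)
      rw [sub_add_cancel] at this
      refine le_trans (le_of_eq ?_) (this.trans (ih x))
      push_cast
      ring_nf
  have h1 : ∀ x, 1 ≤ Φ x := fun x => by
    refine le_of_tendsto (hΦ.tendsto_atTop.comp (Filter.tendsto_atTop_add_const_left _ x
      (tendsto_natCast_atTop_atTop.atTop_mul_const (sub_pos.2 hlt))))
      (Filter.Eventually.of_forall fun k => hstep k x)
  have := ge_of_tendsto' hΦ.tendsto_atBot h1
  linarith

end IsWavePair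

/-- Bézout. Coprimality lets lattice points be placed arbitrarily far ahead of or behind the
interface. -/
lemma exists_fst_eq (hσ : Int.gcd σh σv = 1) (n : ℤ) : ∃ p : latticeX σh σv, p.1.1 = n := by
  have h := Int.gcd_eq_gcd_ab σh σv
  rw [hσ] at h
  refine ⟨⟨(n, n * Int.gcdA σh σv * σv - n * Int.gcdB σh σv * σh), n * Int.gcdA σh σv,
    n * Int.gcdB σh σv, ?_, rfl⟩, rfl⟩
  calc n = n * ((1 : ℕ) : ℤ) := by simp
    _ = _ := by rw [h]; ring

/-! ### Sliding -/

variable {c : ℝ} {Φ : ℝ → ℝ}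

/-- As `c ≠ 0`, the profile is the time history of the wave at the single site `0`, so the bound in
time transfers. -/
lemma IsWavePair.exists_lipschitz (hg : Bistable g) (hΦ : IsWavePair σh σv g c Φ) :
    ∃ D : ℝ, 0 ≤ D ∧ ∀ x y, |Φ x - Φ y| ≤ D * |x - y| := by
  obtain ⟨D, hD0, hD⟩ := IsUnitSolution.exists_lipschitz_time (σh := σh) (σv := σv) hg
  have hc := hΦ.speed_ne_zero
  refine ⟨D / |c|, by positivity, fun x y => ?_⟩
  have h := hD _ (hΦ.isUnitSolution 0) 0 (-(y / c)) (-(x / c))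
  have hval : ∀ z : ℝ, (((0 : latticeX σh σv).1.1 : ℤ) : ℝ) - c * -(z / c) + 0 = z := fun z => by
    simp [mul_div_cancel₀ _ hc]
  simp only [hval] at h
  rwa [show -(x / c) - -(y / c) = -((x - y) / c) by ring, abs_neg, abs_div, ← mul_div_assoc,
    ← div_mul_eq_mul_div] at h

/-- Sliding method: a Lipschitz family of solutions trapped between translates of the wave that
move with the parameter stays above `u` down to `s₀`, if contact can only occur at infinity. -/
lemma le_of_sliding (hg : Bistable g) (hΦ : IsWavePair σh σv g c Φ)
    {u : latticeX σh σv → ℝ → ℝ} (hu : IsUnitSolution g u)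
    {v : ℝ → latticeX σh σv → ℝ → ℝ} (hv : ∀ s, IsUnitSolution g (v s))
    {D : ℝ} (hD0 : 0 ≤ D) (hD : ∀ s s' p t, |v s p t - v s' p t| ≤ D * |s - s'|) {θ : ℝ}
    (huu : ∀ p t, u p t ≤ Φ ((p.1.1 : ℝ) - c * t + θ))
    (hvl : ∀ s p t, Φ ((p.1.1 : ℝ) - c * t + s - θ) ≤ v s p t)
    {s₀ : ℝ}
    (hgap : ∀ s > s₀, (∀ p t, u p t ≤ v s p t) → ∀ L : ℝ, ∃ ε > 0, ∀ p t,
      |(p.1.1 : ℝ) - c * t| ≤ L → u p t + ε ≤ v s p t)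
    (p : latticeX σh σv) (t : ℝ) : u p t ≤ v s₀ p t := by
  obtain ⟨β, hβ, δ, hδ, hdamp⟩ := hg.exists_damping
  obtain ⟨A, hA0, hAl, hAr⟩ := hΦ.exists_tails hδ
  set S : Set ℝ := {s | s₀ ≤ s ∧ ∀ p t, u p t ≤ v s p t} with hS
  have hcont : ∀ p t, Continuous fun s => v s p t := fun p t =>
    (LipschitzWith.of_dist_le' fun s s' => hD s s' p t).continuous
  have hclosed : IsClosed S := by
    have : S = Set.Ici s₀ ∩ ⋂ p, ⋂ t, {s | u p t ≤ v s p t} := by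
      ext s
      simp [hS]
    rw [this]
    exact isClosed_Ici.inter (isClosed_iInter fun p => isClosed_iInter fun t =>
      isClosed_le continuous_const (hcont p t))
  have hne : S.Nonempty := by
    refine ⟨max s₀ (2 * θ), le_max_left _ _, fun p t => (huu p t).trans
      (le_trans (hΦ.monotone ?_) (hvl _ p t))⟩
    linarith [le_max_right s₀ (2 * θ)]
  have hbdd : BddBelow S := ⟨s₀, fun s hs => hs.1⟩
  have hmem : sInf S ∈ S := hclosed.csInf_mem hne hbdd
  set σ := sInf S with hσ
  rcases hmem.1.eq_or_lt with heq | hlt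
  · rw [heq]
    exact hmem.2 p t
  exfalso
  -- Beyond this phase, for every parameter in `[s₀, σ]`, either `u < δ` or `v s > 1 - δ`, so the
  -- damping applies.
  set L := A + |s₀| + |σ| + |θ| with hL
  obtain ⟨ε, hε, hmid⟩ := hgap σ hlt hmem.2 L
  -- The decrease in the parameter costs at most `D * (σ - s) ≤ ε`, so order survives on the strip.
  set s := max s₀ (σ - ε / (D + 1)) with hs
  have hη : 0 < ε / (D + 1) := by positivity
  have hsσ : s < σ := max_lt hlt (by linarith)
  have hs0 : s₀ ≤ s := le_max_left _ _
  refine absurd (csInf_le hbdd (show s ∈ S from ⟨hs0, ?_⟩)) (not_le.2 hsσ)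
  refine hu.le_of_damping (hv s) hβ fun p t hvu_lt => ?_
  refine hdamp _ ((hv s).mem_Icc p t) _ (hu.mem_Icc p t) hvu_lt.le ?_
  have hLx : L < |(p.1.1 : ℝ) - c * t| := by
    by_contra! hle
    have h1 := hmid p t hle
    have h2 := (abs_le.1 (hD σ s p t)).2
    rw [abs_of_pos (sub_pos.2 hsσ)] at h2
    have h3 : D * (σ - s) ≤ D * (ε / (D + 1)) :=
      mul_le_mul_of_nonneg_left (by linarith [le_max_right s₀ (σ - ε / (D + 1))]) hD0
    have h4 : D * (ε / (D + 1)) ≤ ε := by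
      rw [← mul_div_assoc, div_le_iff₀ (by linarith)]
      nlinarith
    linarith
  rcases lt_abs.1 hLx with h | h
  · right
    refine (hAr _ ?_).trans_le (hvl s p t)
    linarith [neg_abs_le s₀, le_abs_self θ, abs_nonneg σ]
  · left
    refine (huu p t).trans_lt (hAl _ ?_)
    linarith [le_abs_self θ, abs_nonneg σ, abs_nonneg s₀]

/-- A trapped solution that lies below one of its translates in the direction of the wave is
uniformly separated from it near the interface. -/
lemma exists_gap_of_translate (hσ : Int.gcd σh σv = 1) (hg : Bistable g)
    (hΦ : IsWavePair σh σv g c Φ)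
    {u : latticeX σh σv → ℝ → ℝ} (hu : IsUnitSolution g u) {θ : ℝ}
    (hul : ∀ p t, Φ ((p.1.1 : ℝ) - c * t - θ) ≤ u p t)
    (huu : ∀ p t, u p t ≤ Φ ((p.1.1 : ℝ) - c * t + θ))
    {q : latticeX σh σv} {τ : ℝ} (hs : 0 < (q.1.1 : ℝ) - c * τ)
    (hle : ∀ p t, u p t ≤ u (p + q) (t + τ)) (L : ℝ) :
    ∃ ε > 0, ∀ p t, |(p.1.1 : ℝ) - c * t| ≤ L → u p t + ε ≤ u (p + q) (t + τ) := by
  obtain ⟨A, hA0, hAl, hAr⟩ := hΦ.exists_tails (δ := 1 / 4) (by norm_num)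
  -- `N` translations by `(q, τ)` cross from phase `≤ -A - |θ|` to phase `≥ A + |θ|`; the extra `1`
  -- pays for the ceiling in `r`. `T` keeps all the chain in the past of `t`, and `r` starts it
  -- behind the interface.
  obtain ⟨N, hN⟩ := exists_nat_ge ((2 * (A + |θ|) + 2 * L + 1) / ((q.1.1 : ℝ) - c * τ))
  rw [div_le_iff₀ hs] at hN
  set T : ℝ := 1 + N * |τ| with hT
  obtain ⟨r, hr⟩ := exists_fst_eq hσ (-⌈A + |θ| + L + c * T⌉)
  have hr' : (r.1.1 : ℝ) = -(⌈A + |θ| + L + c * T⌉ : ℝ) := by rw [hr]; push_cast; rfl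
  have hceil := Int.le_ceil (A + |θ| + L + c * T)
  have hceil' := Int.ceil_lt_add_one (A + |θ| + L + c * T)
  have hH : ∀ j : ℕ, ∃ C : ℝ, 0 ≤ C ∧ (j ≤ N → ∀ p t,
      u (p + (r + j • q) + q) (t - (T - j * τ) + τ) - u (p + (r + j • q)) (t - (T - j * τ))
        ≤ C * (u (p + q) (t + τ) - u p t)) := by
    intro j
    by_cases hj : j ≤ N
    · have hjτ : (j : ℝ) * τ ≤ N * |τ| := 
        (mul_le_mul_of_nonneg_left (le_abs_self τ) (Nat.cast_nonneg j)).trans (by gcongr)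
      obtain ⟨C, hC0, hC⟩ := hu.exists_harnack hg (hu.translate q τ) hle (r + j • q)
        (T := T - j * τ) (by linarith)
      exact ⟨C, hC0, fun _ => hC⟩
    · exact ⟨0, le_rfl, fun h => absurd h hj⟩
  choose C hC0 hC using hH
  set S := ∑ j ∈ Finset.range N, C j with hS
  have hS0 : 0 ≤ S := Finset.sum_nonneg fun j _ => hC0 j
  -- Along the chain `u` climbs from below `1/4` to above `3/4`, while Harnack bounds the climb by
  -- `S` times the gap at `(p, t)`.
  refine ⟨1 / (2 * (S + 1)), by positivity, fun p t hx => ?_⟩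
  obtain ⟨hx1, hx2⟩ := abs_le.1 hx
  set a : ℕ → ℝ := fun j => u (p + (r + j • q)) (t - (T - j * τ)) with ha
  have hsum : a N - a 0 ≤ S * (u (p + q) (t + τ) - u p t) := by
    rw [← Finset.sum_range_sub, hS, Finset.sum_mul]
    refine Finset.sum_le_sum fun j hj => ?_
    refine le_of_eq_of_le ?_ (hC j (Finset.mem_range.1 hj).le p t)
    simp only [ha, succ_nsmul, add_assoc]
    congr 2
    push_cast
    ring
  have ha0 : a 0 < 1 / 4 := by
    refine (huu _ _).trans_lt (hAl _ ?_)
    simp only [zero_smul, add_zero, AddSubgroup.coe_add, Prod.fst_add, Int.cast_add, hr',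
      Nat.cast_zero, zero_mul, sub_zero]
    linarith [le_abs_self θ]
  have haN : 1 - 1 / 4 < a N := by
    refine (hAr _ ?_).trans_le (hul _ _)
    have hq : (((N • q).1.1 : ℤ) : ℝ) = N * (q.1.1 : ℝ) := by simp
    simp only [AddSubgroup.coe_add, Prod.fst_add, Int.cast_add, hr', hq]
    linarith [le_abs_self θ]
  by_contra! hlt
  have h1 : S * (u (p + q) (t + τ) - u p t) ≤ S * (1 / (2 * (S + 1))) :=
    mul_le_mul_of_nonneg_left (by linarith) hS0
  have h2 : S * (1 / (2 * (S + 1))) < 1 / 2 := by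
    rw [mul_one_div, div_lt_div_iff₀ (by positivity) (by norm_num)]
    linarith
  linarith

/-- A trapped solution is non-decreasing, hence constant, along the level sets of the phase. -/
lemma le_translate_of_phase_eq (hσ : Int.gcd σh σv = 1) (hg : Bistable g)
    (hΦ : IsWavePair σh σv g c Φ)
    {u : latticeX σh σv → ℝ → ℝ} (hu : IsUnitSolution g u) {θ : ℝ}
    (hul : ∀ p t, Φ ((p.1.1 : ℝ) - c * t - θ) ≤ u p t)
    (huu : ∀ p t, u p t ≤ Φ ((p.1.1 : ℝ) - c * t + θ))
    (q : latticeX σh σv) (p : latticeX σh σv) (t : ℝ) :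
    u p t ≤ u (p + q) (t + (q.1.1 : ℝ) / c) := by
  obtain ⟨D, hD0, hD⟩ := IsUnitSolution.exists_lipschitz_time (σh := σh) (σv := σv) hg
  have hc := hΦ.speed_ne_zero
  have hphase : ∀ (s : ℝ) (p : latticeX σh σv) (t : ℝ),
      (((p + q).1.1 : ℤ) : ℝ) - c * (t + ((q.1.1 : ℝ) - s) / c) = (p.1.1 : ℝ) - c * t + s := by
    intro s p t
    rw [mul_add, mul_div_cancel₀ _ hc, AddSubgroup.coe_add, Prod.fst_add, Int.cast_add]
    ring
  -- The time shift is chosen so that the translate with parameter `s` advances the phase by exactly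
  -- `s`.
  have h := le_of_sliding hg hΦ hu
    (v := fun s p t => u (p + q) (t + ((q.1.1 : ℝ) - s) / c))
    (fun s => hu.translate q _) (D := D / |c|) (by positivity) (θ := θ) (s₀ := 0)
    (fun s s' p t => ?_) huu (fun s p t => ?_) (fun s hs hle L => ?_) p t
  · simpa using h
  · refine (hD u hu _ _ _).trans (le_of_eq ?_)
    rw [show t + ((q.1.1 : ℝ) - s) / c - (t + ((q.1.1 : ℝ) - s') / c) = -((s - s') / c) by ring,
      abs_neg, abs_div, ← mul_div_assoc, ← div_mul_eq_mul_div]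
  · have := hul (p + q) (t + ((q.1.1 : ℝ) - s) / c)
    rwa [hphase] at this
  · refine exists_gap_of_translate hσ hg hΦ hu hul huu ?_ hle L
    rw [mul_div_cancel₀ _ hc]
    linarith

/-- The inequality for a phase-preserving translation also holds for its inverse. This reduces `u`
to a profile of one real variable, where compactness is available. -/
lemma eq_of_phase_eq (hσ : Int.gcd σh σv = 1) (hg : Bistable g)
    (hΦ : IsWavePair σh σv g c Φ)
    {u : latticeX σh σv → ℝ → ℝ} (hu : IsUnitSolution g u) {θ : ℝ}
    (hul : ∀ p t, Φ ((p.1.1 : ℝ) - c * t - θ) ≤ u p t)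
    (huu : ∀ p t, u p t ≤ Φ ((p.1.1 : ℝ) - c * t + θ)) {p p' : latticeX σh σv} {t t' : ℝ}
    (h : (p.1.1 : ℝ) - c * t = (p'.1.1 : ℝ) - c * t') : u p t = u p' t' := by
  have key : ∀ {p p' : latticeX σh σv} {t t' : ℝ},
      (p.1.1 : ℝ) - c * t = (p'.1.1 : ℝ) - c * t' → u p t ≤ u p' t' := by
    intro p p' t t' h
    have := le_translate_of_phase_eq hσ hg hΦ hu hul huu (p' - p) p t
    have ht : t + (((p' - p).1.1 : ℤ) : ℝ) / c = t' := by
      have hc := hΦ.speed_ne_zero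
      rw [AddSubgroup.coe_sub, Prod.fst_sub, Int.cast_sub]
      field_simp
      linarith
    rwa [ht, add_sub_cancel] at this
  exact (key h).antisymm (key h.symm)

/-- A trapped solution is a translate of the wave. -/
lemma IsUnitSolution.exists_eq_wave (hσ : Int.gcd σh σv = 1) (hg : Bistable g)
    (hΦ : IsWavePair σh σv g c Φ)
    {u : latticeX σh σv → ℝ → ℝ} (hu : IsUnitSolution g u) {θ : ℝ}
    (hul : ∀ p t, Φ ((p.1.1 : ℝ) - c * t - θ) ≤ u p t)
    (huu : ∀ p t, u p t ≤ Φ ((p.1.1 : ℝ) - c * t + θ)) :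
    ∃ θ₀, ∀ p t, u p t = Φ ((p.1.1 : ℝ) - c * t + θ₀) := by
  have hc := hΦ.speed_ne_zero
  obtain ⟨D, hD0, hD⟩ := hΦ.exists_lipschitz hg
  have hphase : ∀ x, (((0 : latticeX σh σv).1.1 : ℤ) : ℝ) - c * (-(x / c)) = x := fun x => by
    simp [mul_div_cancel₀ _ hc]
  have hθ : 0 ≤ θ := by
    have : -θ ≤ θ := hΦ.le_of_translate_le fun x => by
      have h1 := hul 0 (-(x / c))
      have h2 := huu 0 (-(x / c))
      rw [hphase] at h1 h2
      exact h1.trans h2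
    linarith
  -- Sliding the wave down to `s₀` would put a translate of phase `-θ` below one of phase `-θ - 1`,
  -- so it must stop earlier.
  set s₀ := -θ - 1 with hs₀
  have hex : ∃ s > s₀, (∀ p t, u p t ≤ Φ ((p.1.1 : ℝ) - c * t + s)) ∧ ∃ L : ℝ, ∀ ε > 0, ∃ p t,
      |(p.1.1 : ℝ) - c * t| ≤ L ∧ Φ ((p.1.1 : ℝ) - c * t + s) < u p t + ε := by
    by_contra! hno
    have h := le_of_sliding hg hΦ hu (v := fun s p t => Φ ((p.1.1 : ℝ) - c * t + s))
      hΦ.isUnitSolution hD0 (fun s s' p t => by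
        simpa using hD ((p.1.1 : ℝ) - c * t + s) ((p.1.1 : ℝ) - c * t + s'))
      huu (fun s p t => hΦ.monotone (by linarith)) hno
    have : -θ ≤ s₀ := hΦ.le_of_translate_le fun x => by
      have h1 := hul 0 (-(x / c))
      have h2 := h 0 (-(x / c))
      simp only [hphase] at h1 h2
      exact h1.trans h2
    linarith
  obtain ⟨s, -, hle, L, hL⟩ := hex
  have hcont : Continuous fun x => Φ (x + s) - u 0 (-(x / c)) := by
    have h1 : Continuous (u 0) :=
      continuous_iff_continuousAt.2 fun t => (hu.hasDerivAt 0 t).continuousAt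
    have h2 := hΦ.differentiable.continuous
    fun_prop
  have hprofile : ∀ p t, u p t = u 0 (-(((p.1.1 : ℝ) - c * t) / c)) := fun p t =>
    eq_of_phase_eq hσ hg hΦ hu hul huu (by rw [hphase])
  have hne : (Set.Icc (-L) L).Nonempty := by
    obtain ⟨p, t, h, -⟩ := hL 1 one_pos
    exact ⟨_, abs_le.1 h⟩
  obtain ⟨x₀, -, hmin⟩ := isCompact_Icc.exists_isMinOn hne hcont.continuousOn
  -- The gap is smaller than every `ε` somewhere on the interval, so its minimum is a contact.
  have hx₀ : Φ (x₀ + s) - u 0 (-(x₀ / c)) ≤ 0 := by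
    refine le_of_forall_pos_le_add fun ε hε => ?_
    obtain ⟨p, t, h, hlt⟩ := hL ε hε
    have h2 := isMinOn_iff.1 hmin _ (abs_le.1 h)
    rw [← hprofile p t] at h2
    linarith
  refine ⟨s, fun p t => (hle p t).antisymm ?_⟩
  -- a contact point with the same phase, located after time `t`
  obtain ⟨N, hN⟩ := exists_nat_gt ((t + x₀ / c) * |c|)
  obtain ⟨p₁, hp₁⟩ : ∃ p₁ : latticeX σh σv, t < ((p₁.1.1 : ℝ) - x₀) / c := by
    rcases lt_or_gt_of_ne hc with h | h
    · obtain ⟨p₁, hp₁⟩ := exists_fst_eq hσ (-N)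
      refine ⟨p₁, ?_⟩
      rw [abs_of_neg h] at hN
      rw [hp₁, lt_div_iff_of_neg h]
      have : (t + x₀ / c) * -c = -(t * c) - x₀ := by field_simp; ring
      push_cast
      linarith
    · obtain ⟨p₁, hp₁⟩ := exists_fst_eq hσ N
      refine ⟨p₁, ?_⟩
      rw [abs_of_pos h] at hN
      rw [hp₁, lt_div_iff₀ h]
      have : (t + x₀ / c) * c = t * c + x₀ := by field_simp
      push_cast
      linarith
  set t₁ := ((p₁.1.1 : ℝ) - x₀) / c with ht₁
  have hx₁ : (p₁.1.1 : ℝ) - c * t₁ = x₀ := by rw [ht₁, mul_div_cancel₀ _ hc]; ring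
  -- No gap at `(p₁, t₁)` forces no gap at the arbitrary earlier point `(p, t)`.
  obtain ⟨C, hC0, hC⟩ := hu.exists_harnack hg (hΦ.isUnitSolution s) hle (p - p₁)
    (T := t₁ - t) (by linarith)
  have h := hC p₁ t₁
  rw [add_sub_cancel, sub_sub_cancel, hprofile p₁ t₁, hx₁] at h
  have := mul_nonpos_of_nonneg_of_nonpos hC0 hx₀
  linarith

lemma IsEntireSolution.isUnitSolution {ω : ℝ → lp (fun _ : latticeX σh σv => ℝ) ∞}
    (hω : IsEntireSolution σh σv g ω) (h01 : ∀ p t, ω t p ∈ Set.Icc (0 : ℝ) 1) :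
    IsUnitSolution g (fun (p : latticeX σh σv) t => ω t p) where
  hasDerivAt p t := by
    have h := (hω.contDiff.differentiable (by norm_num) t).hasDerivAt
    have h2 := (lp.evalCLM ℝ (fun _ : latticeX σh σv => ℝ) ∞ p).hasFDerivAt.comp_hasDerivAt t h
    rw [← hω.lde]
    exact h2
  mem_Icc := h01

end AllenCahnLattice

theorem mainTheorem9 (σh σv : ℤ) (hσ : Int.gcd σh σv = 1)
    (g : ℝ → ℝ) (hg : AllenCahnLattice.Bistable g)
    (c : ℝ) (Φ : ℝ → ℝ) (hΦ : AllenCahnLattice.IsWavePair σh σv g c Φ)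
    (ω : ℝ → lp (fun _ : AllenCahnLattice.latticeX σh σv => ℝ) ∞)
    (hω : AllenCahnLattice.IsEntireSolution σh σv g ω)
    (θ : ℝ)
    (hlower : ∀ (p : AllenCahnLattice.latticeX σh σv) (t : ℝ),
      Φ ((p.1.1 : ℝ) - c * t - θ) ≤ ω t p)
    (hupper : ∀ (p : AllenCahnLattice.latticeX σh σv) (t : ℝ),
      ω t p ≤ Φ ((p.1.1 : ℝ) - c * t + θ)) :
    ∃ θ₀ ∈ Set.Icc (-θ) θ, ∀ (p : AllenCahnLattice.latticeX σh σv) (t : ℝ),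
      ω t p = Φ ((p.1.1 : ℝ) - c * t + θ₀) := by
  have hu := hω.isUnitSolution fun p t =>
    ⟨(hΦ.mem_Icc _).1.trans (hlower p t), (hupper p t).trans (hΦ.mem_Icc _).2⟩
  obtain ⟨θ₀, hθ₀⟩ := hu.exists_eq_wave hσ hg hΦ hlower hupper
  have hphase : ∀ x, (((0 : AllenCahnLattice.latticeX σh σv).1.1 : ℤ) : ℝ) - c * (-(x / c)) = x :=
    fun x => by simp [mul_div_cancel₀ _ hΦ.speed_ne_zero]
  refine ⟨θ₀, ⟨hΦ.le_of_translate_le fun x => ?_, hΦ.le_of_translate_le fun x => ?_⟩, hθ₀⟩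
  · have h := hlower 0 (-(x / c))
    rwa [hθ₀ 0, hphase] at h
  · have h := hupper 0 (-(x / c))
    rwa [hθ₀ 0, hphase] at h
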